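/- Let $\mathscr{X}$ be a finite non-empty set, $\mathscr{X}^\ast=\bigcup_{n\ge 0}\mathscr{X}^n$ the set of situations (finite strings), $\Omega=\mathscr{X}^{\mathbb N}$ the set of paths, $\omega^n$ the string of the first $n$ states of $\omega\in\Omega$, and $\Gamma(s)$ the set of all paths that have $s\in\mathscr{X}^\ast$ as an initial segment. A function with values in $\overline{\mathbb R}=\mathbb R\cup\{\pm\infty\}$ is called bounded below if it is $\geq c$ for some real $c$. An upper expectation on a non-empty set $\mathscr{Y}$ is a map $\overline{\mathrm E}\colon\overline{\mathbb R}^{\mathscr Y}\to\overline{\mathbb R}$ such that, for all bounded below $f,g\colon\mathscr{Y}\to\overline{\mathbb R}$, all real $c$ and all real $\lambda>0$: $\overline{\mathrm E}(c)=c$; $\overline{\mathrm E}(f+g)\le\overline{\mathrm E}(f)+\overline{\mathrm E}(g)$; $\overline{\mathrm E}(\lambda f)=\lambda\overline{\mathrm E}(f)$; $f\le g$ implies $\overline{\mathrm E}(f)\le\overline{\mathrm E}(g)$; and $\lim_n\overline{\mathrm E}(f_n)=\overline{\mathrm E}(\lim_n f_n)$ for every non-decreasing sequence $(f_n)$ of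 non-negative functions $\mathscr{Y}\to\overline{\mathbb R}$. Let an imprecise probabilities tree be given, that is, an upper expectation $\overline{\mathrm Q}_s$ on $\mathscr{X}$ for every $s\in\mathscr{X}^\ast$. A supermartingale is a map $\mathscr{M}\colon\mathscr{X}^\ast\to\overline{\mathbb R}$ such that $\overline{\mathrm Q}_s(\mathscr{M}(s\,\cdot))\le\mathscr{M}(s)$ for all $s\in\mathscr{X}^\ast$, where $\mathscr{M}(s\,\cdot)$ is the function $x\mapsto\mathscr{M}(sx)$ on $\mathscr{X}$. Let $\overline{\mathbb M}_{\mathrm b}$ be the set of all bounded below supermartingales, and write $\liminf\mathscr{M}(\omega)=\liminf_{n\to\infty}\mathscr{M}(\omega^n)$. For $f\colon\Omega\to\overline{\mathbb R}$ and $s\in\mathscr{X}^\ast$, the game-theoretic upper expectation is $$\overline{\mathrm E}_{\mathrm V}(f\vert s)=\inf\{\mathscr{M}(s)\colon\mathscr{M}\in\overline{\mathbb M}_{\mathrm b},\ \liminf\mathscr{M}(\omega)\ge f(\omega)\text{ for all }\omega\in\Gamma(s)\}.$$ An event $A\subseteq\Omega$ is strictly almost sure within $\Gamma(s)$ if there is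 a non-negative supermartingale $\mathscr{M}$ with $\mathscr{M}(s)=1$ such that $\lim_n\mathscr{M}(\omega^n)=+\infty$ for all $\omega\in\Gamma(s)\setminus A$. We write $\liminf\mathscr{M}\ge_s f$ s.a.s. if the event $\{\omega\in\Omega\colon\liminf\mathscr{M}(\omega)\ge f(\omega)\}$ is strictly almost sure within $\Gamma(s)$. Then: (i) For every $f\colon\Omega\to\overline{\mathbb R}$ and every $s\in\mathscr{X}^\ast$, $$\overline{\mathrm E}_{\mathrm V}(f\vert s)=\inf\{\mathscr{M}(s)\colon\mathscr{M}\in\overline{\mathbb M}_{\mathrm b},\ \liminf\mathscr{M}\ge_s f\text{ s.a.s.}\}.$$ (ii) If moreover $f$ is bounded below, then for every $s\in\mathscr{X}^\ast$ the infimum in (i) is attained, namely by the process $\mathscr{P}\colon t\mapsto\overline{\mathrm E}_{\mathrm V}(f\vert t)$: this $\mathscr{P}$ (which does not depend on $s$) is a bounded below supermartingale, and $\liminf\mathscr{P}\ge_s f$ s.a.s. for every $s\in\mathscr{X}^\ast$. -/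

import Mathlib

open Filter Topology

noncomputable section

namespace GameUpperExpectation

/-- An extended real variable (or process) is bounded below when it is bounded below by a
real number. -/
def IsBddBelow {Y : Type*} (f : Y → EReal) : Prop :=
  ∃ c : ℝ, ∀ y, (c : EReal) ≤ f y

/-- Upper expectations on the set of all extended real variables on `Y`. The sums and products
below only involve values different from `⊥` and positive real factors, so that no
convention about `⊤ + ⊥` plays a role. -/
structure IsUpperExpectation {Y : Type*} (E : (Y → EReal) → EReal) : Prop where
  const : ∀ c : ℝ, E (fun _ => (c : EReal)) = (c : EReal)
  add_le : ∀ f g : Y → EReal, IsBddBelow f → IsBddBelow g →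
    E (fun y => f y + g y) ≤ E f + E g
  smul : ∀ (c : ℝ) (f : Y → EReal), 0 < c → IsBddBelow f →
    E (fun y => (c : EReal) * f y) = (c : EReal) * E f
  mono : ∀ f g : Y → EReal, IsBddBelow f → IsBddBelow g → (∀ y, f y ≤ g y) → E f ≤ E g
  tendsto : ∀ (f : ℕ → Y → EReal) (g : Y → EReal), Monotone f → (∀ n y, 0 ≤ f n y) →
    (∀ y, Tendsto (fun n => f n y) atTop (𝓝 (g y))) →
    Tendsto (fun n => E (f n)) atTop (𝓝 (E g))

/-- An imprecise probabilities tree on the state space `X`: a local upper expectation for every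
situation. Situations are finite strings of states, `[]` is the initial situation, and
`s ++ [x]` is the situation `s` followed by the state `x`. -/
structure ImpreciseTree (X : Type*) where
  loc : List X → (X → EReal) → EReal
  isUpperExpectation : ∀ s, IsUpperExpectation (loc s)

/-- The situation formed by the first `n` states of the path `ω`
(the `n`-th state of the path is `ω (n - 1)`). -/
def initSeg {X : Type*} (ω : ℕ → X) (n : ℕ) : List X :=
  (List.range n).map ω

/-- The cylinder event: the set of all paths through the situation `s`. -/
def cylinder {X : Type*} (s : List X) : Set (ℕ → X) :=
  {ω | initSeg ω s.length = s}

/-- The pathwise limit inferior of a process. -/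
def liminfProcess {X : Type*} (M : List X → EReal) (ω : ℕ → X) : EReal :=
  liminf (fun n => M (initSeg ω n)) atTop

/-- Supermartingales of an imprecise probabilities tree. -/
def IsSupermartingale {X : Type*} (T : ImpreciseTree X) (M : List X → EReal) : Prop :=
  ∀ s, T.loc s (fun x => M (s ++ [x])) ≤ M s

/-- The set of all bounded below supermartingales. -/
def bddSupermartingales {X : Type*} (T : ImpreciseTree X) : Set (List X → EReal) :=
  {M | IsSupermartingale T M ∧ IsBddBelow M}

/-- The global game-theoretic upper expectation of `f` conditional on the situation `s`. -/
def upperExp {X : Type*} (T : ImpreciseTree X) (f : (ℕ → X) → EReal) (s : List X) : EReal :=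
  sInf {a | ∃ M ∈ bddSupermartingales T,
    (∀ ω ∈ cylinder s, f ω ≤ liminfProcess M ω) ∧ M s = a}

/-- `s`-test supermartingales: non-negative supermartingales with value `1` in `s`. -/
def IsTestSupermartingale {X : Type*} (T : ImpreciseTree X) (s : List X)
    (M : List X → EReal) : Prop :=
  M ∈ bddSupermartingales T ∧ (∀ t, 0 ≤ M t) ∧ M s = 1

/-- The event `A` is strictly almost sure within the cylinder event of `s`. -/
def StrictlyAlmostSure {X : Type*} (T : ImpreciseTree X) (s : List X)
    (A : Set (ℕ → X)) : Prop :=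
  ∃ M, IsTestSupermartingale T s M ∧
    ∀ ω ∈ cylinder s \ A, Tendsto (fun n => M (initSeg ω n)) atTop (𝓝 ⊤)

/-- The values in `s` of the bounded below supermartingales whose limit inferior dominates `f`
strictly almost surely within the cylinder event of `s`. -/
def sasHedgingValues {X : Type*} (T : ImpreciseTree X) (f : (ℕ → X) → EReal) (s : List X) :
    Set EReal :=
  {a | ∃ M ∈ bddSupermartingales T,
    StrictlyAlmostSure T s {ω | f ω ≤ liminfProcess M ω} ∧ M s = a}

end GameUpperExpectation

end

/-!
Two ideas carry the proof. First, `upperExp T · s` is countably subadditive on non-negative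
variables, so countably many copies of an event of upper probability zero can be hedged together:
an event is strictly almost sure exactly when its complement has upper probability zero, and
altering `f` on such a complement does not change its upper expectation. This gives (i).

Secondly, let `c` be a lower bound of `f` and let `c < a < b`. On the event that `f` exceeds `b`
while `upperExp T f` falls below `a` infinitely often, a hedge of `f` bought for less than `a`
multiplies the capital in excess of `c` by more than `(b - c) / (a - c)`; it is then sold at a later
visit below `a`, and the gamble is repeated. Hence the upper probability of this event is at most
`((a - c) / (b - c)) ^ n` for every `n`, so it is zero. The union over rational `a < b` is the event
where the limit inferior of `upperExp T f` stays below `f`.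

Along a suitable path a supermartingale stays below any bound exceeding its current value, so a
hedge of a variable that is at least `c` is itself at least `c` in every situation where it hedges.
-/

namespace GameUpperExpectation

variable {X Y : Type*} {T : ImpreciseTree X} {M N : List X → EReal} {f g : (ℕ → X) → EReal}
  {s t : List X}

/-! ### Situations and paths -/

theorem initSeg_succ (ω : ℕ → X) (n : ℕ) : initSeg ω (n + 1) = initSeg ω n ++ [ω n] := by
  simp [initSeg, List.range_succ]

@[simp]
theorem length_initSeg (ω : ℕ → X) (n : ℕ) : (initSeg ω n).length = n := by
  simp [initSeg]

theorem initSeg_mem_cylinder (ω : ℕ → X) (n : ℕ) : ω ∈ cylinder (initSeg ω n) := by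
  simp [cylinder]

theorem take_initSeg (ω : ℕ → X) (k n : ℕ) : (initSeg ω n).take k = initSeg ω (min k n) := by
  simp [initSeg, ← List.map_take, List.take_range]

theorem prefix_initSeg {ω : ℕ → X} (hω : ω ∈ cylinder s) {n : ℕ} (hn : s.length ≤ n) :
    s <+: initSeg ω n := by
  rw [List.prefix_iff_eq_take, take_initSeg, min_eq_left hn]
  exact hω.symm

theorem cylinder_subset_of_prefix (h : s <+: t) : cylinder t ⊆ cylinder s := by
  intro ω (hω : initSeg ω t.length = t)
  have hs : s = initSeg ω s.length := by
    rw [← hω, List.prefix_iff_eq_take, take_initSeg] at h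
    rwa [min_eq_left (by simpa using congrArg List.length h)] at h
  exact hs.symm

theorem exists_path_forall_initSeg {P : List X → Prop} (hs : P s)
    (hstep : ∀ t, P t → ∃ x, P (t ++ [x])) :
    ∃ ω ∈ cylinder s, ∀ n, s.length ≤ n → P (initSeg ω n) := by
  obtain ⟨x, -⟩ := hstep s hs
  have : Nonempty X := ⟨x⟩
  choose! next hnext using hstep
  let extend : ℕ → List X := fun n => (fun t => t ++ [next t])^[n] s
  have extend_succ : ∀ n, extend (n + 1) = extend n ++ [next (extend n)] := fun n =>
    Function.iterate_succ_apply' _ n s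
  let ω : ℕ → X := fun n => if h : n < s.length then s[n] else next (extend (n - s.length))
  have hω : initSeg ω s.length = s :=
    List.ext_getElem (by simp) fun i _ hi => by simp [initSeg, ω, hi]
  have initSeg_eq : ∀ n, initSeg ω (s.length + n) = extend n := by
    intro n
    induction n with
    | zero => exact hω
    | succ n ih =>
      rw [← add_assoc, initSeg_succ, ih, extend_succ]
      simp [ω]
  refine ⟨ω, hω, fun n hn => ?_⟩
  obtain ⟨k, rfl⟩ := Nat.exists_eq_add_of_le hn
  rw [initSeg_eq]
  induction k with
  | zero => exact hs
  | succ k ih =>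
    rw [extend_succ]
    exact hnext _ (ih (by omega))

/-! ### Bounded below supermartingales -/

theorem IsBddBelow.comp {Z : Type*} {u : Y → EReal} (hu : IsBddBelow u) (h : Z → Y) :
    IsBddBelow (fun z => u (h z)) :=
  hu.imp fun _ hc z => hc (h z)

theorem IsBddBelow.of_nonneg {u : Y → EReal} (hu : ∀ y, 0 ≤ u y) : IsBddBelow u :=
  ⟨0, by simpa using hu⟩

theorem IsBddBelow.add {u v : Y → EReal} (hu : IsBddBelow u) (hv : IsBddBelow v) :
    IsBddBelow (fun y => u y + v y) := by
  obtain ⟨a, ha⟩ := hu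
  obtain ⟨b, hb⟩ := hv
  exact ⟨a + b, fun y => by rw [EReal.coe_add]; exact add_le_add (ha y) (hb y)⟩

theorem IsBddBelow.const_mul {u : Y → EReal} (hu : IsBddBelow u) {c : ℝ} (hc : 0 ≤ c) :
    IsBddBelow (fun y => (c : EReal) * u y) := by
  obtain ⟨a, ha⟩ := hu
  exact ⟨c * a, fun y => by
    rw [EReal.coe_mul]; exact mul_le_mul_of_nonneg_left (ha y) (EReal.coe_nonneg.2 hc)⟩

theorem const_mem_bddSupermartingales (T : ImpreciseTree X) (c : ℝ) :
    (fun _ => (c : EReal)) ∈ bddSupermartingales T :=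
  ⟨fun s => ((T.isUpperExpectation s).const c).le, c, fun _ => le_rfl⟩

theorem top_mem_bddSupermartingales (T : ImpreciseTree X) :
    (fun _ => ⊤) ∈ bddSupermartingales T :=
  ⟨fun _ => le_top, 0, fun _ => le_top⟩

theorem add_mem_bddSupermartingales (hM : M ∈ bddSupermartingales T)
    (hN : N ∈ bddSupermartingales T) : (fun t => M t + N t) ∈ bddSupermartingales T :=
  ⟨fun s => ((T.isUpperExpectation s).add_le _ _ (hM.2.comp _) (hN.2.comp _)).trans
    (add_le_add (hM.1 s) (hN.1 s)), hM.2.add hN.2⟩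

theorem const_mul_mem_bddSupermartingales (hM : M ∈ bddSupermartingales T) {c : ℝ}
    (hc : 0 < c) : (fun t => (c : EReal) * M t) ∈ bddSupermartingales T :=
  ⟨fun s => ((T.isUpperExpectation s).smul c _ hc (hM.2.comp _)).le.trans
    (mul_le_mul_of_nonneg_left (hM.1 s) (EReal.coe_nonneg.2 hc.le)), hM.2.const_mul hc.le⟩

theorem sum_mem_bddSupermartingales {ι : Type*} {M : ι → List X → EReal} (A : Finset ι)
    (hM : ∀ i ∈ A, M i ∈ bddSupermartingales T) :
    (fun t => ∑ i ∈ A, M i t) ∈ bddSupermartingales T := by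
  classical
  induction A using Finset.induction_on with
  | empty => simpa using const_mem_bddSupermartingales T 0
  | insert i A hi ih =>
    simp only [Finset.sum_insert hi]
    exact add_mem_bddSupermartingales (hM i (Finset.mem_insert_self i A))
      (ih fun j hj => hM j (Finset.mem_insert_of_mem hj))

theorem iSup_mem_bddSupermartingales {M : ℕ → List X → EReal}
    (hM : ∀ n, M n ∈ bddSupermartingales T) (hM_nonneg : ∀ n t, 0 ≤ M n t) (hmono : Monotone M) :
    (fun t => ⨆ n, M n t) ∈ bddSupermartingales T := by
  refine ⟨fun t => ?_, .of_nonneg fun t => (hM_nonneg 0 t).trans (le_iSup (M · t) 0)⟩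
  have hlim := (T.isUpperExpectation t).tendsto (fun n x => M n (t ++ [x]))
    (fun x => ⨆ n, M n (t ++ [x])) (fun _ _ hmn x => hmono hmn _) (fun n x => hM_nonneg n _)
    (fun x => tendsto_atTop_iSup fun _ _ hmn => hmono hmn _)
  exact le_of_tendsto' hlim fun n => ((hM n).1 t).trans (le_iSup (M · t) n)

theorem exists_lt_of_mem_bddSupermartingales (hM : M ∈ bddSupermartingales T) {r : EReal}
    (hr : M s < r) : ∃ x, M (s ++ [x]) < r := by
  by_contra! hge
  obtain ⟨y, hMy, hyr⟩ := EReal.lt_iff_exists_real_btwn.1 hr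
  have hy : (y : EReal) ≤ T.loc s fun x => M (s ++ [x]) := by
    rw [← (T.isUpperExpectation s).const y]
    exact (T.isUpperExpectation s).mono _ _ ⟨y, fun _ => le_rfl⟩ (hM.2.comp _)
      fun x => hyr.le.trans (hge x)
  exact hMy.not_ge (hy.trans (hM.1 s))

theorem exists_path_liminfProcess_le (hM : M ∈ bddSupermartingales T) {r : EReal}
    (hr : M s < r) : ∃ ω ∈ cylinder s, liminfProcess M ω ≤ r := by
  obtain ⟨ω, hω, hlt⟩ := exists_path_forall_initSeg (P := fun t => M t < r) hr
    fun _ => exists_lt_of_mem_bddSupermartingales hM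
  exact ⟨ω, hω, liminf_le_of_frequently_le'
    ((eventually_ge_atTop s.length).mono fun n hn => (hlt n hn).le).frequently⟩

theorem le_of_forall_le_liminfProcess (hM : M ∈ bddSupermartingales T) {c : EReal}
    (hc : ∀ ω ∈ cylinder s, c ≤ liminfProcess M ω) : c ≤ M s :=
  le_of_forall_gt_imp_ge_of_dense fun _ hr =>
    let ⟨ω, hω, hle⟩ := exists_path_liminfProcess_le hM hr
    (hc ω hω).trans hle

theorem sum_liminfProcess_le {ι : Type*} (A : Finset ι) (M : ι → List X → EReal) (ω : ℕ → X) :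
    ∑ i ∈ A, liminfProcess (M i) ω ≤ liminfProcess (fun t => ∑ i ∈ A, M i t) ω := by
  classical
  induction A using Finset.induction_on with
  | empty => simp [liminfProcess]
  | insert i A hi ih =>
    simp only [Finset.sum_insert hi]
    exact (add_le_add le_rfl ih).trans EReal.le_liminf_add

theorem liminfProcess_mono (h : ∀ t, M t ≤ N t) (ω : ℕ → X) :
    liminfProcess M ω ≤ liminfProcess N ω :=
  liminf_le_liminf (.of_forall fun _ => h _)

/-! ### Switching supermartingales -/

section Switching

variable {D : Set (List X)} {W : List X → EReal} {V : List X → List X → EReal}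

open Classical in
/-- The first situation of `D` that is passed on the way to `t`, that is, the shortest initial
segment of `t` in `D` (`t` itself included), if there is one. -/
noncomputable def firstHit (D : Set (List X)) (t : List X) : Option (List X) :=
  t.inits.find? (· ∈ D)

theorem firstHit_eq_none_iff : firstHit D t = none ↔ ∀ v, v <+: t → v ∉ D := by
  simp [firstHit]

theorem mem_of_firstHit_eq_some {v : List X} (h : firstHit D t = some v) : v ∈ D := by
  simpa using List.find?_some h

theorem prefix_of_firstHit_eq_some {v : List X} (h : firstHit D t = some v) : v <+: t :=
  (List.mem_inits v t).1 (List.mem_of_find?_eq_some h)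

theorem firstHit_of_mem (ht : t ∈ D) (hD : ∀ v ∈ D, v <+: t → v = t) :
    firstHit D t = some t := by
  obtain ⟨v, hv⟩ := Option.ne_none_iff_exists'.1 fun hnone =>
    firstHit_eq_none_iff.1 hnone t List.prefix_rfl ht
  rw [hv, hD v (mem_of_firstHit_eq_some hv) (prefix_of_firstHit_eq_some hv)]

open Classical in
theorem firstHit_append_singleton (D : Set (List X)) (t : List X) (x : X) :
    firstHit D (t ++ [x]) =
      (firstHit D t).or (if t ++ [x] ∈ D then some (t ++ [x]) else none) := by
  simp [firstHit, List.inits_append, List.find?_singleton]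

theorem exists_eventually_firstHit_eq_some {ω : ℕ → X} (h : ∃ n, initSeg ω n ∈ D) :
    ∃ v ∈ D, ω ∈ cylinder v ∧ ∀ᶠ n in atTop, firstHit D (initSeg ω n) = some v := by
  obtain ⟨m, hm⟩ := h
  obtain ⟨v, hv⟩ := Option.ne_none_iff_exists'.1 fun hnone =>
    firstHit_eq_none_iff.1 hnone _ List.prefix_rfl hm
  refine ⟨v, mem_of_firstHit_eq_some hv,
    cylinder_subset_of_prefix (prefix_of_firstHit_eq_some hv) (initSeg_mem_cylinder ω m), ?_⟩
  filter_upwards [eventually_ge_atTop m] with n hn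
  induction n, hn using Nat.le_induction with
  | base => exact hv
  | succ n _ ih => rw [initSeg_succ, firstHit_append_singleton, ih, Option.some_or]

/-- The process that follows `W` until a situation in `D` is reached, and from the first such
situation `v` on follows `V v`. -/
noncomputable def switchAt (D : Set (List X)) (W : List X → EReal) (V : List X → List X → EReal)
    (t : List X) : EReal :=
  (firstHit D t).elim (W t) fun v => V v t

theorem switchAt_of_firstHit_eq_none (h : firstHit D t = none) : switchAt D W V t = W t := by
  simp [switchAt, h]

theorem switchAt_of_firstHit_eq_some {v : List X} (h : firstHit D t = some v) :
    switchAt D W V t = V v t := by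
  simp [switchAt, h]

theorem le_switchAt {c : EReal} (hW : ∀ t, c ≤ W t) (hV : ∀ v ∈ D, ∀ t, v <+: t → c ≤ V v t)
    (t : List X) : c ≤ switchAt D W V t := by
  cases h : firstHit D t with
  | none => exact (hW t).trans_eq (switchAt_of_firstHit_eq_none h).symm
  | some v =>
    exact (hV v (mem_of_firstHit_eq_some h) t (prefix_of_firstHit_eq_some h)).trans_eq
      (switchAt_of_firstHit_eq_some h).symm

theorem switchAt_le_of_prefix (hVW : ∀ v ∈ D, V v v ≤ W v) (hD : ∀ v ∈ D, v <+: t → v = t) :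
    switchAt D W V t ≤ W t := by
  cases h : firstHit D t with
  | none => exact (switchAt_of_firstHit_eq_none h).le
  | some v =>
    have hv := mem_of_firstHit_eq_some h
    obtain rfl := hD v hv (prefix_of_firstHit_eq_some h)
    exact (switchAt_of_firstHit_eq_some h).trans_le (hVW v hv)

theorem switchAt_append_singleton_le (hVW : ∀ v ∈ D, V v v ≤ W v) (h : firstHit D t = none)
    (x : X) : switchAt D W V (t ++ [x]) ≤ W (t ++ [x]) := by
  refine switchAt_le_of_prefix hVW fun v hv hvt => ?_
  exact (List.prefix_concat_iff.1 hvt).resolve_right fun hpre => firstHit_eq_none_iff.1 h v hpre hv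

theorem switchAt_mem_bddSupermartingales {c : ℝ} (hW : W ∈ bddSupermartingales T)
    (hV : ∀ v ∈ D, IsSupermartingale T (V v)) (hc : ∀ v ∈ D, ∀ t, v <+: t → (c : EReal) ≤ V v t)
    (hVW : ∀ v ∈ D, V v v ≤ W v) : switchAt D W V ∈ bddSupermartingales T := by
  have hbdd : IsBddBelow (switchAt D W V) := by
    obtain ⟨d, hd⟩ := hW.2
    exact ⟨min c d, le_switchAt (fun t => le_trans (by simp) (hd t))
      fun v hv t hvt => le_trans (by simp) (hc v hv t hvt)⟩
  refine ⟨fun t => ?_, hbdd⟩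
  cases h : firstHit D t with
  | none =>
    rw [switchAt_of_firstHit_eq_none h]
    exact ((T.isUpperExpectation t).mono _ _ (hbdd.comp _) (hW.2.comp _)
      (switchAt_append_singleton_le hVW h)).trans (hW.1 t)
  | some v =>
    have hchild : ∀ x, switchAt D W V (t ++ [x]) = V v (t ++ [x]) := fun x =>
      switchAt_of_firstHit_eq_some (by rw [firstHit_append_singleton, h, Option.some_or])
    simp only [hchild, switchAt_of_firstHit_eq_some h]
    exact hV v (mem_of_firstHit_eq_some h) t

theorem exists_liminfProcess_switchAt_eq {ω : ℕ → X} (W : List X → EReal)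
    (V : List X → List X → EReal) (h : ∃ n, initSeg ω n ∈ D) :
    ∃ v ∈ D, ω ∈ cylinder v ∧ liminfProcess (switchAt D W V) ω = liminfProcess (V v) ω := by
  obtain ⟨v, hv, hωv, hev⟩ := exists_eventually_firstHit_eq_some h
  exact ⟨v, hv, hωv, liminf_congr (hev.mono fun _ => switchAt_of_firstHit_eq_some)⟩

theorem liminfProcess_switchAt_of_forall_notMem {ω : ℕ → X} (W : List X → EReal)
    (V : List X → List X → EReal) (h : ∀ n, initSeg ω n ∉ D) :
    liminfProcess (switchAt D W V) ω = liminfProcess W ω := by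
  refine congrArg (liminf · atTop) (funext fun n => switchAt_of_firstHit_eq_none ?_)
  refine firstHit_eq_none_iff.2 fun v hv hvD => h v.length ?_
  rwa [show initSeg ω v.length = v from
    cylinder_subset_of_prefix hv (initSeg_mem_cylinder ω n)]

end Switching

/-! ### Properties of the upper expectation -/

theorem upperExp_le (hM : M ∈ bddSupermartingales T)
    (hf : ∀ ω ∈ cylinder s, f ω ≤ liminfProcess M ω) : upperExp T f s ≤ M s :=
  sInf_le ⟨M, hM, hf, rfl⟩

theorem upperExp_lt_iff {z : EReal} : upperExp T f s < z ↔
    ∃ M ∈ bddSupermartingales T, (∀ ω ∈ cylinder s, f ω ≤ liminfProcess M ω) ∧ M s < z := by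
  simp only [upperExp, sInf_lt_iff, Set.mem_ofPred_eq]
  exact ⟨fun ⟨_, ⟨M, hM, hf, rfl⟩, hz⟩ => ⟨M, hM, hf, hz⟩,
    fun ⟨M, hM, hf, hz⟩ => ⟨_, ⟨M, hM, hf, rfl⟩, hz⟩⟩

theorem upperExp_mono (h : ∀ ω ∈ cylinder s, f ω ≤ g ω) : upperExp T f s ≤ upperExp T g s :=
  sInf_le_sInf fun _ ⟨M, hM, hg, hMs⟩ => ⟨M, hM, fun ω hω => (h ω hω).trans (hg ω hω), hMs⟩

theorem le_upperExp {c : EReal} (hf : ∀ ω ∈ cylinder s, c ≤ f ω) : c ≤ upperExp T f s := by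
  refine le_sInf ?_
  rintro _ ⟨M, hM, hMf, rfl⟩
  exact le_of_forall_le_liminfProcess hM fun ω hω => (hf ω hω).trans (hMf ω hω)

theorem upperExp_le_of_forall_le {c : ℝ} (hf : ∀ ω ∈ cylinder s, f ω ≤ c) :
    upperExp T f s ≤ c :=
  upperExp_le (const_mem_bddSupermartingales T c) fun ω hω => by
    simpa [liminfProcess] using hf ω hω

theorem upperExp_mem_bddSupermartingales (T : ImpreciseTree X) (hf : IsBddBelow f) :
    upperExp T f ∈ bddSupermartingales T := by
  have hbdd : IsBddBelow (upperExp T f) := hf.imp fun _ hc _ => le_upperExp fun ω _ => hc ω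
  refine ⟨fun s => le_sInf ?_, hbdd⟩
  rintro _ ⟨M, hM, hMf, rfl⟩
  refine ((T.isUpperExpectation s).mono _ _ (hbdd.comp _) (hM.2.comp _) fun x => ?_).trans (hM.1 s)
  exact upperExp_le hM fun ω hω => hMf ω (cylinder_subset_of_prefix (List.prefix_append _ _) hω)

theorem upperExp_add_le (hf : IsBddBelow f) (hg : IsBddBelow g) :
    upperExp T (fun ω => f ω + g ω) s ≤ upperExp T f s + upperExp T g s := by
  have ne_bot : ∀ {h : (ℕ → X) → EReal}, IsBddBelow h → upperExp T h s ≠ ⊥ :=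
    fun ⟨c, hc⟩ => ne_bot_of_le_ne_bot (EReal.coe_ne_bot c) (le_upperExp fun ω _ => hc ω)
  refine EReal.le_add_of_forall_gt (.inl (ne_bot hf)) (.inr (ne_bot hg)) fun a ha b hb => ?_
  obtain ⟨M, hM, hMf, hMa⟩ := upperExp_lt_iff.1 ha
  obtain ⟨N, hN, hNg, hNb⟩ := upperExp_lt_iff.1 hb
  exact (upperExp_le (add_mem_bddSupermartingales hM hN) fun ω hω =>
    (add_le_add (hMf ω hω) (hNg ω hω)).trans EReal.le_liminf_add).trans
      (add_le_add hMa.le hNb.le)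

theorem exists_ge_of_upperExp_lt {c : ℝ} (hc : ∀ ω ∈ cylinder s, (c : EReal) ≤ f ω) {z : EReal}
    (hz : upperExp T f s < z) :
    ∃ M ∈ bddSupermartingales T, (∀ t, (c : EReal) ≤ M t) ∧
      (∀ ω ∈ cylinder s, f ω ≤ liminfProcess M ω) ∧ M s < z := by
  obtain ⟨M, hM, hMf, hMz⟩ := upperExp_lt_iff.1 hz
  have hcM : ∀ v ∈ ({s} : Set (List X)), ∀ t, v <+: t → (c : EReal) ≤ M t := by
    rintro _ rfl t hst
    exact le_of_forall_le_liminfProcess hM fun ω hω =>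
      have hωs := cylinder_subset_of_prefix hst hω
      (hc ω hωs).trans (hMf ω hωs)
  refine ⟨switchAt {s} (fun _ => ⊤) fun _ => M,
    switchAt_mem_bddSupermartingales (top_mem_bddSupermartingales T) (fun _ _ => hM.1) hcM
      fun _ _ => le_top,
    le_switchAt (fun _ => le_top) hcM, fun ω hω => ?_,
    (switchAt_of_firstHit_eq_some
      (firstHit_of_mem (Set.mem_singleton s) fun _ hv _ => hv)).trans_lt hMz⟩
  obtain ⟨_, -, -, heq⟩ := exists_liminfProcess_switchAt_eq (D := {s}) (fun _ => ⊤) (fun _ => M)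
    ⟨s.length, hω⟩
  exact (hMf ω hω).trans_eq heq.symm

-- Follow `W` until its value suffices to buy a hedge of `f`, then switch to that hedge.
theorem upperExp_le_of_hitting {W : List X → EReal} (hf : IsBddBelow f)
    (hW : W ∈ bddSupermartingales T)
    (hit : ∀ ω ∈ cylinder s, f ω ≤ liminfProcess W ω ∨
      ∃ n, s.length ≤ n ∧ upperExp T f (initSeg ω n) < W (initSeg ω n)) :
    upperExp T f s ≤ W s := by
  obtain ⟨c, hc⟩ := hf
  let D : Set (List X) := {v | s <+: v ∧ upperExp T f v < W v}
  have hedge : ∀ v ∈ D, ∃ N ∈ bddSupermartingales T,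
      (∀ ω ∈ cylinder v, f ω ≤ liminfProcess N ω) ∧ N v < W v := fun v hv =>
    upperExp_lt_iff.1 hv.2
  choose! V hV hVf hVW using hedge
  have hcV : ∀ v ∈ D, ∀ t, v <+: t → (c : EReal) ≤ V v t := fun v hv t hvt =>
    le_of_forall_le_liminfProcess (hV v hv) fun ω hω =>
      (hc ω).trans (hVf v hv ω (cylinder_subset_of_prefix hvt hω))
  have hVW' : ∀ v ∈ D, V v v ≤ W v := fun v hv => (hVW v hv).le
  refine (upperExp_le (switchAt_mem_bddSupermartingales hW (fun v hv => (hV v hv).1) hcV hVW')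
    fun ω hω => ?_).trans
      (switchAt_le_of_prefix hVW' fun v hv hvs => hvs.eq_of_length_le hv.1.length_le)
  by_cases hD : ∃ n, initSeg ω n ∈ D
  · obtain ⟨v, hv, hωv, heq⟩ := exists_liminfProcess_switchAt_eq W V hD
    exact (hVf v hv ω hωv).trans_eq heq.symm
  · rw [not_exists] at hD
    rw [liminfProcess_switchAt_of_forall_notMem W V hD]
    exact (hit ω hω).resolve_right fun ⟨n, hn, hlt⟩ => hD n ⟨prefix_initSeg hω hn, hlt⟩

theorem upperExp_iSup_sum_le_of_le_liminfProcess {f : ℕ → (ℕ → X) → EReal}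
    {M : ℕ → List X → EReal} (hM : ∀ k, M k ∈ bddSupermartingales T)
    (hM_nonneg : ∀ k t, 0 ≤ M k t) (hMf : ∀ k, ∀ ω ∈ cylinder s, f k ω ≤ liminfProcess (M k) ω) :
    upperExp T (fun ω => ⨆ n, ∑ k ∈ Finset.range n, f k ω) s ≤
      ⨆ n, ∑ k ∈ Finset.range n, M k s := by
  have hmono : Monotone fun n t => ∑ k ∈ Finset.range n, M k t := fun m n hmn t =>
    Finset.sum_le_sum_of_subset_of_nonneg (Finset.range_mono hmn) fun k _ _ => hM_nonneg k t
  refine upperExp_le (iSup_mem_bddSupermartingales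
    (fun n => sum_mem_bddSupermartingales (Finset.range n) fun k _ => hM k)
    (fun n t => Finset.sum_nonneg fun k _ => hM_nonneg k t) hmono) fun ω hω => iSup_le fun n => ?_
  calc ∑ k ∈ Finset.range n, f k ω
      ≤ ∑ k ∈ Finset.range n, liminfProcess (M k) ω := Finset.sum_le_sum fun k _ => hMf k ω hω
    _ ≤ liminfProcess (fun t => ∑ k ∈ Finset.range n, M k t) ω := sum_liminfProcess_le _ _ _
    _ ≤ liminfProcess (fun t => ⨆ n, ∑ k ∈ Finset.range n, M k t) ω :=
      liminfProcess_mono (fun t => le_iSup (fun n => ∑ k ∈ Finset.range n, M k t) n) ω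

theorem ereal_coe_sum {ι : Type*} (A : Finset ι) (a : ι → ℝ) :
    ((∑ i ∈ A, a i : ℝ) : EReal) = ∑ i ∈ A, (a i : EReal) :=
  map_sum (⟨⟨(↑), EReal.coe_zero⟩, EReal.coe_add⟩ : ℝ →+ EReal) a A

theorem upperExp_iSup_sum_le {f : ℕ → (ℕ → X) → EReal} (hf : ∀ k ω, 0 ≤ f k ω) (s : List X) :
    upperExp T (fun ω => ⨆ n, ∑ k ∈ Finset.range n, f k ω) s ≤
      ⨆ n, ∑ k ∈ Finset.range n, upperExp T (f k) s := by
  have hE_nonneg : ∀ k, 0 ≤ upperExp T (f k) s := fun k => le_upperExp fun ω _ => hf k ω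
  refine EReal.le_of_forall_lt_iff_le.1 fun z hz => ?_
  obtain ⟨y, hy, hyz⟩ := EReal.lt_iff_exists_real_btwn.1 hz
  have hsum_le : ∀ n, ∑ k ∈ Finset.range n, upperExp T (f k) s ≤ y := fun n =>
    (le_iSup (fun n => ∑ k ∈ Finset.range n, upperExp T (f k) s) n).trans hy.le
  let ε : ℕ → ℝ := fun k => (z - y) / 2 / 2 ^ k
  have hε_pos : ∀ k, 0 < ε k := fun k => by
    have := sub_pos.2 (EReal.coe_lt_coe_iff.1 hyz)
    positivity
  have hE_lt : ∀ k, upperExp T (f k) s < upperExp T (f k) s + ε k := fun k => by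
    have hle : upperExp T (f k) s ≤ y :=
      (Finset.single_le_sum (fun i _ => hE_nonneg i) (Finset.self_mem_range_succ k)).trans
        (hsum_le (k + 1))
    lift upperExp T (f k) s to ℝ using ⟨ne_top_of_le_ne_top (EReal.coe_ne_top y) hle,
      ne_bot_of_le_ne_bot EReal.zero_ne_bot (hE_nonneg k)⟩ with e
    exact_mod_cast lt_add_of_pos_right e (hε_pos k)
  choose M hM hM_nonneg hMf hMlt using fun k =>
    exists_ge_of_upperExp_lt (c := 0) (fun ω _ => hf k ω) (hE_lt k)
  refine (upperExp_iSup_sum_le_of_le_liminfProcess hM hM_nonneg hMf).trans (iSup_le fun n => ?_)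
  have hε_sum : ∑ k ∈ Finset.range n, ε k ≤ z - y :=
    sum_le_hasSum _ (fun k _ => (hε_pos k).le) (hasSum_geometric_two' (z - y))
  calc ∑ k ∈ Finset.range n, M k s
      ≤ ∑ k ∈ Finset.range n, (upperExp T (f k) s + ε k) :=
        Finset.sum_le_sum fun k _ => (hMlt k).le
    _ = ∑ k ∈ Finset.range n, upperExp T (f k) s + ((∑ k ∈ Finset.range n, ε k : ℝ) : EReal) := by
        rw [Finset.sum_add_distrib, ereal_coe_sum]
    _ ≤ y + ((z - y : ℝ) : EReal) := add_le_add (hsum_le n) (EReal.coe_le_coe_iff.2 hε_sum)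
    _ = z := by rw [← EReal.coe_add, add_sub_cancel]

/-! ### Null events -/

/-- The event `A` is null within the cylinder event of `s`: its upper probability, that is, the
upper expectation of its indicator, vanishes. Since upper probabilities are non-negative, this is
encoded as `≤ 0`. -/
def IsNull (T : ImpreciseTree X) (s : List X) (A : Set (ℕ → X)) : Prop :=
  upperExp T (A.indicator 1) s ≤ 0

theorem indicator_one_nonneg (A : Set (ℕ → X)) (ω : ℕ → X) :
    (0 : EReal) ≤ A.indicator 1 ω :=
  Set.indicator_nonneg (fun _ _ => zero_le_one) ω

theorem IsNull.mono {A B : Set (ℕ → X)} (hB : IsNull T s B) (h : A ∩ cylinder s ⊆ B) :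
    IsNull T s A := by
  refine (upperExp_mono fun ω hω => ?_).trans hB
  by_cases hA : ω ∈ A
  · simp [hA, h ⟨hA, hω⟩]
  · simpa [hA] using indicator_one_nonneg B ω

theorem isNull_empty (T : ImpreciseTree X) (s : List X) : IsNull T s ∅ :=
  upperExp_le_of_forall_le (c := 0) (by simp)

theorem upperExp_le_zero_of_le_iSup_sum {f : ℕ → (ℕ → X) → EReal} (hf : ∀ k ω, 0 ≤ f k ω)
    (hnull : ∀ k, upperExp T (f k) s ≤ 0)
    (hg : ∀ ω ∈ cylinder s, g ω ≤ ⨆ n, ∑ k ∈ Finset.range n, f k ω) : upperExp T g s ≤ 0 :=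
  (upperExp_mono hg).trans <| (upperExp_iSup_sum_le hf s).trans <|
    iSup_le fun _ => Finset.sum_nonpos fun k _ => hnull k

theorem isNull_iUnion {ι : Sort*} [Countable ι] {A : ι → Set (ℕ → X)}
    (hA : ∀ i, IsNull T s (A i)) : IsNull T s (⋃ i, A i) := by
  cases isEmpty_or_nonempty ι
  · simpa using isNull_empty T s
  obtain ⟨e, he⟩ := exists_surjective_nat ι
  refine upperExp_le_zero_of_le_iSup_sum (fun k => indicator_one_nonneg (A (e k)))
    (fun k => hA (e k)) fun ω _ => ?_
  by_cases hω : ω ∈ ⋃ i, A i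
  · obtain ⟨i, hi⟩ := Set.mem_iUnion.1 hω
    obtain ⟨k, rfl⟩ := he i
    calc (⋃ i, A i).indicator (1 : (ℕ → X) → EReal) ω = (A (e k)).indicator 1 ω := by
          rw [Set.indicator_of_mem hω, Set.indicator_of_mem hi]
      _ ≤ ∑ k ∈ Finset.range (k + 1), (A (e k)).indicator 1 ω :=
          Finset.single_le_sum (f := fun k => (A (e k)).indicator (1 : (ℕ → X) → EReal) ω)
            (fun j _ => indicator_one_nonneg (A (e j)) ω) (Finset.self_mem_range_succ k)
      _ ≤ _ := le_iSup (fun n => ∑ k ∈ Finset.range n, (A (e k)).indicator _ ω) (k + 1)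
  · rw [Set.indicator_of_notMem hω]
    exact le_iSup_of_le 0 (by simp)

-- Countable subadditivity applied to countably many copies of the same event.
theorem IsNull.upperExp_indicator_top_le {A : Set (ℕ → X)} (hA : IsNull T s A) :
    upperExp T (A.indicator ⊤) s ≤ 0 := by
  refine upperExp_le_zero_of_le_iSup_sum (fun _ => indicator_one_nonneg A) (fun _ => hA)
    fun ω _ => ?_
  by_cases hω : ω ∈ A
  · have hcount : ∀ n : ℕ, ∑ _k ∈ Finset.range n, A.indicator (1 : (ℕ → X) → EReal) ω = n := by
      simp [hω]
    refine le_of_le_of_eq le_top ((EReal.eq_top_iff_forall_lt _).2 fun y => ?_).symm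
    obtain ⟨n, hn⟩ := exists_nat_gt y
    simp only [hcount]
    exact (EReal.coe_lt_coe_iff.2 hn).trans_le (le_iSup (fun n : ℕ => (n : EReal)) n)
  · simp [hω]

theorem StrictlyAlmostSure.isNull_compl {A : Set (ℕ → X)} (hA : StrictlyAlmostSure T s A) :
    IsNull T s Aᶜ := by
  obtain ⟨N, ⟨hN, hN_nonneg, hNs⟩, htop⟩ := hA
  refine EReal.le_of_forall_lt_iff_le.1 fun ε hε => ?_
  have hε : 0 < ε := EReal.coe_pos.1 hε
  have hε_nonneg : (0 : EReal) ≤ ε := EReal.coe_nonneg.2 hε.le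
  refine (upperExp_le (const_mul_mem_bddSupermartingales hN hε) fun ω hω => ?_).trans
    (by simp [hNs])
  refine le_liminf_of_le (h := ?_)
  by_cases hωA : ω ∈ A
  · exact .of_forall fun n => by simpa [hωA] using mul_nonneg hε_nonneg (hN_nonneg _)
  · filter_upwards [(htop ω ⟨hω, hωA⟩).eventually_const_le (EReal.coe_lt_top ε⁻¹)] with n hn
    calc Aᶜ.indicator (1 : (ℕ → X) → EReal) ω = (ε : EReal) * (ε⁻¹ : ℝ) := by
          rw [Set.indicator_of_mem hωA, ← EReal.coe_mul, mul_inv_cancel₀ hε.ne']; rfl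
      _ ≤ ε * N (initSeg ω n) := mul_le_mul_of_nonneg_left hn hε_nonneg

theorem IsNull.strictlyAlmostSure_compl {A : Set (ℕ → X)} (hA : IsNull T s A) :
    StrictlyAlmostSure T s Aᶜ := by
  obtain ⟨M, hM, hM_nonneg, hMtop, hMs⟩ := exists_ge_of_upperExp_lt (c := 0)
    (fun ω _ => Set.indicator_nonneg (fun _ _ => le_top) ω)
    (hA.upperExp_indicator_top_le.trans_lt zero_lt_one)
  obtain ⟨m, hm⟩ : ∃ m : ℝ, (m : EReal) = M s :=
    ⟨_, EReal.coe_toReal hMs.ne_top (ne_bot_of_le_ne_bot EReal.zero_ne_bot (hM_nonneg s))⟩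
  have hm1 : 0 ≤ 1 - m := by
    rw [← hm] at hMs
    exact sub_nonneg.2 (EReal.coe_lt_coe_iff.1 hMs).le
  have hle : ∀ t, M t ≤ M t + (1 - m : ℝ) := fun t =>
    le_add_of_nonneg_right (EReal.coe_nonneg.2 hm1)
  refine ⟨fun t => M t + (1 - m : ℝ),
    ⟨add_mem_bddSupermartingales hM (const_mem_bddSupermartingales T (1 - m)),
      fun t => (hM_nonneg t).trans (hle t), ?_⟩, fun ω hω => ?_⟩
  · change M s + (1 - m : ℝ) = 1
    rw [← hm, ← EReal.coe_add, add_sub_cancel, EReal.coe_one]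
  · have hωA : ω ∈ A := not_not.1 hω.2
    have htop : liminfProcess M ω = ⊤ := top_le_iff.1 (by simpa [hωA] using hMtop ω hω.1)
    exact tendsto_nhds_top_mono' (tendsto_of_le_liminf_of_limsup_le htop.ge le_top)
      fun n => hle (initSeg ω n)

theorem upperExp_le_of_strictlyAlmostSure (hM : M ∈ bddSupermartingales T)
    (h : StrictlyAlmostSure T s {ω | f ω ≤ liminfProcess M ω}) : upperExp T f s ≤ M s := by
  set A : Set (ℕ → X) := {ω | f ω ≤ liminfProcess M ω}
  have hM_bdd : IsBddBelow (liminfProcess M) := hM.2.imp fun c hc ω =>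
    le_liminf_of_le (h := .of_forall fun n => hc (initSeg ω n))
  have hA_nonneg : ∀ ω, (0 : EReal) ≤ Aᶜ.indicator ⊤ ω :=
    Set.indicator_nonneg fun _ _ => le_top
  have hle : ∀ ω, f ω ≤ liminfProcess M ω + Aᶜ.indicator ⊤ ω := fun ω => by
    by_cases hω : ω ∈ A
    · exact le_add_of_le_of_nonneg hω (hA_nonneg ω)
    · obtain ⟨c, hc⟩ := hM_bdd
      rw [Set.indicator_of_mem hω, Pi.top_apply,
        EReal.add_top_of_ne_bot (ne_bot_of_le_ne_bot (EReal.coe_ne_bot c) (hc ω))]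
      exact le_top
  calc upperExp T f s ≤ upperExp T (fun ω => liminfProcess M ω + Aᶜ.indicator ⊤ ω) s :=
        upperExp_mono fun ω _ => hle ω
    _ ≤ upperExp T (liminfProcess M) s + upperExp T (Aᶜ.indicator ⊤) s :=
        upperExp_add_le hM_bdd (.of_nonneg hA_nonneg)
    _ ≤ M s + 0 :=
        add_le_add (upperExp_le hM fun _ _ => le_rfl) h.isNull_compl.upperExp_indicator_top_le
    _ = M s := add_zero _

theorem strictlyAlmostSure_of_cylinder_subset (T : ImpreciseTree X) {A : Set (ℕ → X)}
    (h : cylinder s ⊆ A) : StrictlyAlmostSure T s A :=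
  ⟨fun _ => ((1 : ℝ) : EReal), ⟨const_mem_bddSupermartingales T 1, by simp, by simp⟩,
    fun _ hω => absurd (h hω.1) hω.2⟩

theorem upperExp_eq_sInf_sasHedgingValues (T : ImpreciseTree X) (f : (ℕ → X) → EReal)
    (s : List X) : upperExp T f s = sInf (sasHedgingValues T f s) := by
  apply le_antisymm
  · refine le_sInf ?_
    rintro _ ⟨M, hM, hMf, rfl⟩
    exact upperExp_le_of_strictlyAlmostSure hM hMf
  · refine sInf_le_sInf ?_
    rintro _ ⟨M, hM, hMf, rfl⟩
    exact ⟨M, hM, strictlyAlmostSure_of_cylinder_subset T hMf, rfl⟩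

/-! ### Crossings -/

/-- The event that `f` exceeds `b` although its conditional upper expectations fall below `a`
infinitely often. -/
def crossingEvent (T : ImpreciseTree X) (f : (ℕ → X) → EReal) (a b : ℝ) : Set (ℕ → X) :=
  {ω | (b : EReal) < f ω ∧ ∃ᶠ n in atTop, upperExp T f (initSeg ω n) < a}

/-- The affine map of the extended reals that sends `c` to `0` and `b` to `δ`, for `c < b` and
`0 ≤ δ`; it turns a supermartingale bounded below by `c` into a non-negative one whose value
exceeds `δ` wherever the original exceeds `b`. -/
noncomputable def rescale (c b δ : ℝ) (y : EReal) : EReal :=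
  (δ / (b - c) : ℝ) * (y + (-c : ℝ))

section Crossing

variable {a b c δ : ℝ}

theorem rescale_coe (c b δ y : ℝ) : rescale c b δ y = (δ * ((y - c) / (b - c)) : ℝ) := by
  rw [rescale, ← EReal.coe_add, ← EReal.coe_mul, ← sub_eq_add_neg, div_mul_eq_mul_div,
    mul_div_assoc]

theorem monotone_rescale (hcb : c < b) (hδ : 0 ≤ δ) : Monotone (rescale c b δ) := fun _ _ hyz =>
  mul_le_mul_of_nonneg_left (add_le_add hyz le_rfl)
    (EReal.coe_nonneg.2 (div_nonneg hδ (sub_nonneg.2 hcb.le)))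

theorem rescale_nonneg (hcb : c < b) (hδ : 0 ≤ δ) {y : EReal} (hy : c ≤ y) :
    0 ≤ rescale c b δ y := by
  have h := monotone_rescale hcb hδ hy
  rwa [rescale_coe, sub_self, zero_div, mul_zero, EReal.coe_zero] at h

theorem lt_rescale (hcb : c < b) (hδ : 0 < δ) {y : EReal} (hy : b < y) :
    (δ : EReal) < rescale c b δ y := by
  obtain ⟨z, hbz, hzy⟩ := EReal.lt_iff_exists_real_btwn.1 hy
  refine lt_of_lt_of_le ?_ (monotone_rescale hcb hδ.le hzy.le)
  rw [rescale_coe, EReal.coe_lt_coe_iff]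
  exact lt_mul_of_one_lt_right hδ ((one_lt_div (sub_pos.2 hcb)).2
    (sub_lt_sub_right (EReal.coe_lt_coe_iff.1 hbz) c))

theorem rescale_mem_bddSupermartingales (hM : M ∈ bddSupermartingales T) (hcb : c < b)
    (hδ : 0 < δ) : (fun t => rescale c b δ (M t)) ∈ bddSupermartingales T :=
  const_mul_mem_bddSupermartingales
    (add_mem_bddSupermartingales hM (const_mem_bddSupermartingales T (-c)))
    (div_pos hδ (sub_pos.2 hcb))

-- A hedge `M` of `f` with `M t < a` exceeds `b` eventually on the crossing event, so at a later
-- visit below `a` its rescaling is worth more than `δ`, enough to start all over again.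
theorem upperExp_indicator_crossingEvent_le_mul (hc : ∀ ω, (c : EReal) ≤ f ω) (hcb : c < b)
    (hδ : 0 < δ)
    (hle : ∀ v, upperExp T f v < a → upperExp T ((crossingEvent T f a b).indicator 1) v ≤ δ)
    (ht : upperExp T f t < a) :
    upperExp T ((crossingEvent T f a b).indicator 1) t ≤ (δ * ((a - c) / (b - c)) : ℝ) := by
  obtain ⟨M, hM, hcM, hMf, hMt⟩ := exists_ge_of_upperExp_lt (fun ω _ => hc ω) ht
  refine (upperExp_le_of_hitting (.of_nonneg (indicator_one_nonneg _))
    (rescale_mem_bddSupermartingales hM hcb hδ) fun ω hω => ?_).trans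
      ((monotone_rescale hcb hδ.le hMt.le).trans_eq (rescale_coe c b δ a))
  by_cases hA : ω ∈ crossingEvent T f a b
  · have hbM : ∀ᶠ n in atTop, (b : EReal) < M (initSeg ω n) :=
      eventually_lt_of_lt_liminf (hA.1.trans_le (hMf ω hω))
    obtain ⟨n, hna, hnb, hn⟩ :=
      (hA.2.and_eventually (hbM.and (eventually_ge_atTop t.length))).exists
    exact .inr ⟨n, hn, (hle _ hna).trans_lt (lt_rescale hcb hδ hnb)⟩
  · refine .inl ?_
    rw [Set.indicator_of_notMem hA]
    exact le_liminf_of_le (h := .of_forall fun n => rescale_nonneg hcb hδ.le (hcM _))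

theorem isNull_crossingEvent (hf : IsBddBelow f) (hab : a < b) (s : List X) :
    IsNull T s (crossingEvent T f a b) := by
  obtain ⟨d, hd⟩ := hf
  obtain ⟨c, hc, hca⟩ : ∃ c : ℝ, (∀ ω, (c : EReal) ≤ f ω) ∧ c < a :=
    ⟨min d (a - 1), fun ω => le_trans (by simp) (hd ω), by simp⟩
  let r := (a - c) / (b - c)
  have hr_pos : 0 < r := div_pos (by linarith) (by linarith)
  have hr_lt : r < 1 := (div_lt_one (by linarith)).2 (by linarith)
  have hpow : ∀ n : ℕ, ∀ v, upperExp T f v < a →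
      upperExp T ((crossingEvent T f a b).indicator 1) v ≤ (r ^ n : ℝ) := by
    intro n
    induction n with
    | zero =>
      intro v _
      refine upperExp_le_of_forall_le fun ω _ => ?_
      rw [pow_zero, EReal.coe_one]
      exact Set.indicator_le_self' (fun _ _ => zero_le_one) ω
    | succ n ih =>
      rw [pow_succ]
      exact fun v hv =>
        upperExp_indicator_crossingEvent_le_mul hc (hca.trans hab) (pow_pos hr_pos n) ih hv
  refine EReal.le_of_forall_lt_iff_le.1 fun ε hε => ?_
  obtain ⟨n, hn⟩ := exists_pow_lt_of_lt_one (EReal.coe_pos.1 hε) hr_lt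
  refine upperExp_le_of_hitting (.of_nonneg (indicator_one_nonneg _))
    (const_mem_bddSupermartingales T ε) fun ω _ => ?_
  by_cases hA : ω ∈ crossingEvent T f a b
  · obtain ⟨m, hm, hsm⟩ := (hA.2.and_eventually (eventually_ge_atTop s.length)).exists
    exact .inr ⟨m, hsm, (hpow n _ hm).trans_lt (EReal.coe_lt_coe_iff.2 hn)⟩
  · exact .inl (by simpa [hA, liminfProcess] using hε.le)

end Crossing

theorem strictlyAlmostSure_le_liminfProcess_upperExp (T : ImpreciseTree X) (hf : IsBddBelow f)
    (s : List X) : StrictlyAlmostSure T s {ω | f ω ≤ liminfProcess (upperExp T f) ω} := by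
  have hnull : IsNull T s (⋃ (a : ℚ) (b : ℚ) (_ : a < b), crossingEvent T f a b) :=
    isNull_iUnion fun a => isNull_iUnion fun b => isNull_iUnion fun hab =>
      isNull_crossingEvent hf (Rat.cast_lt.2 hab) s
  rw [← compl_compl {ω | f ω ≤ liminfProcess (upperExp T f) ω}]
  refine (hnull.mono fun ω hω => ?_).strictlyAlmostSure_compl
  have hlt : liminfProcess (upperExp T f) ω < f ω := not_le.1 hω.1
  obtain ⟨b, hb, hbf⟩ := EReal.lt_iff_exists_rat_btwn.1 hlt
  obtain ⟨a, ha, hab⟩ := EReal.lt_iff_exists_rat_btwn.1 hb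
  have hab : a < b := Rat.cast_lt.1 (EReal.coe_lt_coe_iff.1 hab)
  exact Set.mem_iUnion₂.2 ⟨a, b, Set.mem_iUnion.2 ⟨hab, hbf, frequently_lt_of_liminf_lt (h := ha)⟩⟩

end GameUpperExpectation

open GameUpperExpectation in
theorem mainTheorem12_general {X : Type*} (T : ImpreciseTree X) :
    (∀ (f : (ℕ → X) → EReal) (s : List X), upperExp T f s = sInf (sasHedgingValues T f s)) ∧
    (∀ f : (ℕ → X) → EReal, IsBddBelow f →
      (fun t => upperExp T f t) ∈ bddSupermartingales T ∧
      ∀ s : List X,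
        StrictlyAlmostSure T s {ω | f ω ≤ liminfProcess (fun t => upperExp T f t) ω} ∧
        IsLeast (sasHedgingValues T f s) (upperExp T f s)) := by
  refine ⟨upperExp_eq_sInf_sasHedgingValues T, fun f hf => ?_⟩
  have hP := upperExp_mem_bddSupermartingales T hf
  refine ⟨hP, fun s => ?_⟩
  have hPf := strictlyAlmostSure_le_liminfProcess_upperExp T hf s
  refine ⟨hPf, ⟨_, hP, hPf, rfl⟩, ?_⟩
  rintro _ ⟨M, hM, hMf, rfl⟩
  exact upperExp_le_of_strictlyAlmostSure hM hMf

theorem mainTheorem12 {X : Type*} [Finite X] [Nonempty X]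
    (T : GameUpperExpectation.ImpreciseTree X) :
    (∀ (f : (ℕ → X) → EReal) (s : List X),
      GameUpperExpectation.upperExp T f s =
        sInf (GameUpperExpectation.sasHedgingValues T f s)) ∧
    (∀ f : (ℕ → X) → EReal, GameUpperExpectation.IsBddBelow f →
      (fun t => GameUpperExpectation.upperExp T f t) ∈
          GameUpperExpectation.bddSupermartingales T ∧
      ∀ s : List X,
        GameUpperExpectation.StrictlyAlmostSure T s
          {ω | f ω ≤ GameUpperExpectation.liminfProcess
            (fun t => GameUpperExpectation.upperExp T f t) ω} ∧
        IsLeast (GameUpperExpectation.sasHedgingValues T f s)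
          (GameUpperExpectation.upperExp T f s)) :=
  mainTheorem12_general T
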